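/- Identify a point of $\mathbb{R}^3$ with its coordinates $(x,y,z)$ and let $\kappa>0$. A \emph{$\kappa$-cylindrical surface} is a cylindrical ruled surface $$S=\{\alpha(s)+t\,\vec w:\ s\in[a,b],\ t\in\mathbb{R}\},\qquad a<b,$$ where $\vec w$ is a unit vector and $\alpha$ is a continuous curve on $[a,b]$ that on $(a,b)$ is of class $C^2$, parametrized by arc length and satisfies $\alpha'\perp\vec w$, oriented by a unit normal field $N=N(s)$ that is continuous on $[a,b]$, whose mean curvature $H$ with respect to $N$ is proportional to the height: $$2H=\kappa z .$$ Let $c\in\mathbb{R}$ and $0<\gamma\le\pi$. We say that $S$ \emph{rests on the horizontal plane $\Pi=\{z=c\}$ with contact angle $\gamma$} if the two boundary lines $s=a$ and $s=b$ lie on $\Pi$, if $0<z<c$ on the rest of $S$, and if $\langle N,(0,0,1)\rangle=\cos\gamma$ along both boundary lines. (Thus the liquid lies between $S$ and $\Pi$, $N$ points into the liquid, and $\gamma$ is the angle between $S$ and $\Pi$ measured inside the liquid.) The \emph{volume per unit length} enclosed by such an $S$ is $$\mathcal V=\int_a^b\bigl(c-z(\alpha(s))\bigr)\,\langle N(s),(0,0,1)\rangle\,ds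 .$$ For a profile that is symmetric about $r=0$ and ends at $(r,u(r))$ with $u(r)=c$, this is $\mathcal V=2\bigl(r\,u(r)-\int_0^r u\,dr\bigr)$, where the integral is taken along the profile if the latter is not a graph. \textbf{Theorem.} Let $\kappa>0$, $V>0$ and $0<\gamma\le\pi$. Up to congruence by height-preserving isometries of $\mathbb{R}^3$, there is exactly one $\kappa$-cylindrical surface that rests on a horizontal plane with contact angle $\gamma$ and has volume per unit length $\mathcal V=V$. That is, there are a height $c$ and such a surface $S$ resting on $\{z=c\}$, and if $S'$ is any such surface, resting on $\{z=c'\}$, then $c'=c$ and $S'=g(S)$ for some isometry $g$ of $\mathbb{R}^3$ that preserves the $z$-coordinate. -/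

import Mathlib

open scoped InnerProductSpace

noncomputable section

/-- Euclidean three-space with coordinates `(x, y, z) = (p 0, p 1, p 2)`. The reference level, at
which the capillary equation has right-hand side zero, is `z = 0`. -/
abbrev E3 : Type := EuclideanSpace ℝ (Fin 3)

/-- The mean curvature `(e G - 2 f F + g E) / (2 (E G - F ^ 2))` at the parameter `(s, t)` of a
parametrized surface `X` with unit normal `N` there, from its first fundamental form `E, F, G`
and its second fundamental form `e, f, g`. -/
def meanCurvature (X : ℝ → ℝ → E3) (N : E3) (s t : ℝ) : ℝ :=
  let Xs : ℝ → ℝ → E3 := fun σ τ => deriv (fun σ' => X σ' τ) σ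
  let Xt : ℝ → ℝ → E3 := fun σ τ => deriv (fun τ' => X σ τ') τ
  let E : ℝ := ⟪Xs s t, Xs s t⟫_ℝ
  let F : ℝ := ⟪Xs s t, Xt s t⟫_ℝ
  let G : ℝ := ⟪Xt s t, Xt s t⟫_ℝ
  let e : ℝ := ⟪deriv (fun σ => Xs σ t) s, N⟫_ℝ
  let f : ℝ := ⟪deriv (fun τ => Xs s τ) t, N⟫_ℝ
  let g : ℝ := ⟪deriv (fun τ => Xt s τ) t, N⟫_ℝ
  (e * G - 2 * f * F + g * E) / (2 * (E * G - F ^ 2))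

/-- The point `α s + t • w` of the cylindrical ruled surface with directrix `α` and ruling
direction `w`. -/
def ruledPoint (α : ℝ → E3) (w : E3) (s t : ℝ) : E3 := α s + t • w

/-- A cylindrical ruled surface `{α s + t • w | s ∈ [a, b], t ∈ ℝ}`, with unit ruling direction
`w` and directrix `α` parametrized by arc length and orthogonal to `w`, oriented by a continuous
unit normal field `N` (constant along the rulings), which satisfies the capillary equation
`2 H = κ z`, that is, whose mean curvature is `κ / 2` times the height. -/
structure CylindricalSurface (κ : ℝ) where
  a : ℝ
  b : ℝ
  a_lt_b : a < b
  w : E3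
  norm_w : ‖w‖ = 1
  α : ℝ → E3
  continuousOn_α : ContinuousOn α (Set.Icc a b)
  contDiffOn_α : ContDiffOn ℝ 2 α (Set.Ioo a b)
  norm_deriv_α : ∀ s ∈ Set.Ioo a b, ‖deriv α s‖ = 1
  inner_deriv_α_w : ∀ s ∈ Set.Ioo a b, ⟪deriv α s, w⟫_ℝ = 0
  N : ℝ → E3
  continuousOn_N : ContinuousOn N (Set.Icc a b)
  norm_N : ∀ s ∈ Set.Ioo a b, ‖N s‖ = 1
  inner_N_deriv_α : ∀ s ∈ Set.Ioo a b, ⟪N s, deriv α s⟫_ℝ = 0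
  inner_N_w : ∀ s ∈ Set.Ioo a b, ⟪N s, w⟫_ℝ = 0
  capillary : ∀ s ∈ Set.Ioo a b, ∀ t : ℝ,
    2 * meanCurvature (ruledPoint α w) (N s) s t = κ * (ruledPoint α w s t) 2

namespace CylindricalSurface

/-- The surface as a set of points of space. -/
def carrier {κ : ℝ} (S : CylindricalSurface κ) : Set E3 :=
  {p | ∃ s ∈ Set.Icc S.a S.b, ∃ t : ℝ, p = ruledPoint S.α S.w s t}

/-- `S` rests on the horizontal plane `z = c` with contact angle `γ`: the two boundary lines lie
on the plane, the rest of `S` lies strictly on one side of it at positive heights, and along the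
boundary lines the normal `N`, which points from `S` into the liquid enclosed between `S` and the
plane, makes the angle `γ` with the normal `(0, 0, 1)` of the plane pointing out of the liquid
(so `γ` is the angle, within the liquid, between `S` and the plane). -/
structure RestsOn {κ : ℝ} (S : CylindricalSurface κ) (c γ : ℝ) : Prop where
  boundary_left : ∀ t : ℝ, (ruledPoint S.α S.w S.a t) 2 = c
  boundary_right : ∀ t : ℝ, (ruledPoint S.α S.w S.b t) 2 = c
  height_pos : ∀ s ∈ Set.Ioo S.a S.b, ∀ t : ℝ, 0 < (ruledPoint S.α S.w s t) 2
  height_lt : ∀ s ∈ Set.Ioo S.a S.b, ∀ t : ℝ, (ruledPoint S.α S.w s t) 2 < c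
  angle_left : (S.N S.a) 2 = Real.cos γ
  angle_right : (S.N S.b) 2 = Real.cos γ

/-- The volume per unit length enclosed between `S` and the plane `z = c`, as the integral
`∫ (c - z) ⟨N, (0, 0, 1)⟩ ds` over the profile. For the profile with inclination angle `θ` one has
`⟨N, (0, 0, 1)⟩ = cos θ` and `cos θ ds = dr`, so for a profile symmetric about `r = 0`
which ends at `(r, u r)`, `c = u r`, this is `2 (r u(r) - ∫₀ʳ u dr)`, with the integral
taken along the profile where the profile is not a graph. -/
def volume {κ : ℝ} (S : CylindricalSurface κ) (c : ℝ) : ℝ :=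
  ∫ s in S.a..S.b, (c - (S.α s) 2) * (S.N s) 2

end CylindricalSurface

end

/-! Use the inclination θ of the profile as parameter, which also covers profiles that are not
graphs. Along a profile with velocity (cos θ, sin θ) the equation reads dθ/ds = κ u, and cos θ + κ
u²/2 is constant. With lowest height √m this gives u² = m + 2 (1 - cos θ) / κ, so the profiles form
a one-parameter family, each cut off at θ = ±γ.

Every resting surface is one of these up to a height-preserving isometry (`exists_inclination`,
`CylindricalSurface.RestsOn.exists_profile`), and every m > 0 occurs (`exists_cylindricalSurface`).
After an integration by parts (`integral_profile`) the volume is ∫ sin² θ · u(γ) / (κ² u(θ)³) over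
[-γ, γ]. For |θ| ≤ γ ≤ π the integrand decreases with m, so the volume determines m
(`profileVolume_injOn`). It tends to 0 as m → ∞ and is unbounded as m → 0, so by continuity every V
> 0 is attained (`exists_profileVolume_eq`). -/

noncomputable section

/-- The height of the profile with lowest height `√m`, as a function of the inclination. -/
def profileHeight (κ m θ : ℝ) : ℝ := √(m + 2 * (1 - Real.cos θ) / κ)

/-- The horizontal coordinate along the profile, as a function of the inclination. -/
def profileRadius (κ m θ : ℝ) : ℝ :=
  ∫ τ in (0 : ℝ)..θ, Real.cos τ / (κ * profileHeight κ m τ)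

/-- The arc length along the profile from its lowest point, as a function of the inclination. -/
def profileLength (κ m θ : ℝ) : ℝ := ∫ τ in (0 : ℝ)..θ, 1 / (κ * profileHeight κ m τ)

/-- The volume per unit length below the horizontal plane met at inclination `γ`. -/
def profileVolume (κ γ m : ℝ) : ℝ :=
  ∫ θ in (-γ)..γ, Real.sin θ ^ 2 * profileHeight κ m γ / (κ ^ 2 * profileHeight κ m θ ^ 3)

/-! ### Basic properties of the profiles -/

section Profile

variable {κ m γ : ℝ}

theorem profileRadicand_pos (hκ : 0 < κ) (hm : 0 < m) (θ : ℝ) :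
    0 < m + 2 * (1 - Real.cos θ) / κ := by
  have := Real.cos_le_one θ
  have : 0 ≤ 2 * (1 - Real.cos θ) / κ := div_nonneg (by linarith) hκ.le
  linarith

theorem profileHeight_pos (hκ : 0 < κ) (hm : 0 < m) (θ : ℝ) : 0 < profileHeight κ m θ :=
  Real.sqrt_pos.2 (profileRadicand_pos hκ hm θ)

theorem sq_profileHeight (hκ : 0 < κ) (hm : 0 < m) (θ : ℝ) :
    profileHeight κ m θ ^ 2 = m + 2 * (1 - Real.cos θ) / κ :=
  Real.sq_sqrt (profileRadicand_pos hκ hm θ).le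

theorem profileHeight_neg (κ m θ : ℝ) : profileHeight κ m (-θ) = profileHeight κ m θ := by
  simp [profileHeight]

theorem continuous_profileHeight (κ m : ℝ) : Continuous (profileHeight κ m) := by
  unfold profileHeight; fun_prop

theorem hasDerivAt_profileHeight (hκ : 0 < κ) (hm : 0 < m) (θ : ℝ) :
    HasDerivAt (profileHeight κ m) (Real.sin θ / (κ * profileHeight κ m θ)) θ := by
  have h1 : HasDerivAt (fun θ => m + 2 * (1 - Real.cos θ) / κ) (2 * Real.sin θ / κ) θ := by
    have := ((((Real.hasDerivAt_cos θ).const_sub 1).const_mul 2).div_const κ).const_add m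
    simpa using this
  have h2 := h1.sqrt (profileRadicand_pos hκ hm θ).ne'
  refine h2.congr_deriv ?_
  have := profileHeight_pos hκ hm θ
  change _ / (2 * profileHeight κ m θ) = _
  field_simp

theorem hasDerivAt_profileRadius (hκ : 0 < κ) (hm : 0 < m) (θ : ℝ) :
    HasDerivAt (profileRadius κ m) (Real.cos θ / (κ * profileHeight κ m θ)) θ := by
  have hc : Continuous fun τ => Real.cos τ / (κ * profileHeight κ m τ) :=
    Real.continuous_cos.div (continuous_const.mul (continuous_profileHeight κ m))
      fun τ => (mul_pos hκ (profileHeight_pos hκ hm τ)).ne'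
  exact (hc.integral_hasStrictDerivAt 0 θ).hasDerivAt

theorem hasDerivAt_profileLength (hκ : 0 < κ) (hm : 0 < m) (θ : ℝ) :
    HasDerivAt (profileLength κ m) (1 / (κ * profileHeight κ m θ)) θ := by
  have hc : Continuous fun τ => 1 / (κ * profileHeight κ m τ) :=
    continuous_const.div (continuous_const.mul (continuous_profileHeight κ m))
      fun τ => (mul_pos hκ (profileHeight_pos hκ hm τ)).ne'
  exact (hc.integral_hasStrictDerivAt 0 θ).hasDerivAt

theorem continuous_profileVolume_integrand (hκ : 0 < κ) (hm : 0 < m) :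
    Continuous fun θ =>
      Real.sin θ ^ 2 * profileHeight κ m γ / (κ ^ 2 * profileHeight κ m θ ^ 3) :=
  ((Real.continuous_sin.pow 2).mul continuous_const).div
    (continuous_const.mul ((continuous_profileHeight κ m).pow 3))
    fun τ => by have := profileHeight_pos hκ hm τ; positivity

theorem profileHeight_lt (hκ : 0 < κ) (hm : 0 < m) (hγπ : γ ≤ Real.pi) {θ : ℝ}
    (h₁ : -γ < θ) (h₂ : θ < γ) : profileHeight κ m θ < profileHeight κ m γ := by
  refine Real.sqrt_lt_sqrt (profileRadicand_pos hκ hm θ).le ?_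
  have : Real.cos γ < Real.cos θ := by
    rw [← Real.cos_abs θ]
    exact Real.cos_lt_cos_of_nonneg_of_le_pi (abs_nonneg _) hγπ (abs_lt.2 ⟨h₁, h₂⟩)
  gcongr

theorem profileHeight_le (hκ : 0 < κ) (hγπ : γ ≤ Real.pi) {θ : ℝ}
    (h₁ : -γ ≤ θ) (h₂ : θ ≤ γ) : profileHeight κ m θ ≤ profileHeight κ m γ := by
  refine Real.sqrt_le_sqrt ?_
  have : Real.cos γ ≤ Real.cos θ := by
    rw [← Real.cos_abs θ]
    exact Real.cos_le_cos_of_nonneg_of_le_pi (abs_nonneg _) hγπ (abs_le.2 ⟨h₁, h₂⟩)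
  gcongr

/-- The squared ratio u(γ)² / u(θ)² has the form (m + A) / (m + B) with A ≥ B, hence does not
increase with m; the remaining factor 1 / u(θ)² strictly decreases. -/
theorem profileHeight_div_cube_lt (hκ : 0 < κ) (hγπ : γ ≤ Real.pi) {m₁ m₂ : ℝ}
    (hm₁ : 0 < m₁) (h₁₂ : m₁ < m₂) {θ : ℝ} (h₁ : -γ ≤ θ) (h₂ : θ ≤ γ) :
    profileHeight κ m₂ γ / profileHeight κ m₂ θ ^ 3 <
      profileHeight κ m₁ γ / profileHeight κ m₁ θ ^ 3 := by
  have hm₂ := hm₁.trans h₁₂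
  have p1 := profileHeight_pos hκ hm₁ θ
  have p2 := profileHeight_pos hκ hm₂ θ
  have g1 := profileHeight_pos hκ hm₁ γ
  have g2 := profileHeight_pos hκ hm₂ γ
  have q1 := sq_profileHeight hκ hm₁ θ
  have q2 := sq_profileHeight hκ hm₂ θ
  have r1 := sq_profileHeight hκ hm₁ γ
  have r2 := sq_profileHeight hκ hm₂ γ
  have hle := profileHeight_le (m := m₁) hκ hγπ h₁ h₂
  have hratio : profileHeight κ m₂ γ / profileHeight κ m₂ θ ≤
      profileHeight κ m₁ γ / profileHeight κ m₁ θ := by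
    rw [div_le_div_iff₀ p2 p1]
    refine abs_le_of_sq_le_sq' ?_ (by positivity) |>.2
    rw [mul_pow, mul_pow, q1, q2, r1, r2]
    have : 2 * (1 - Real.cos θ) / κ ≤ 2 * (1 - Real.cos γ) / κ := by
      have := pow_le_pow_left₀ p1.le hle 2
      rw [q1, r1] at this
      linarith
    nlinarith
  have e : ∀ x y : ℝ, x / y ^ 3 = x / y * (1 / y ^ 2) := fun x y => by
    rw [div_mul_div_comm, mul_one, ← pow_succ']
  rw [e, e]
  refine mul_lt_mul' hratio ?_ (by positivity) (by positivity)
  exact one_div_lt_one_div_of_lt (by positivity) (by rw [q1, q2]; linarith)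

theorem profileVolume_lt (hκ : 0 < κ) (hγ : 0 < γ) (hγπ : γ ≤ Real.pi) {m₁ m₂ : ℝ}
    (hm₁ : 0 < m₁) (h₁₂ : m₁ < m₂) : profileVolume κ γ m₂ < profileVolume κ γ m₁ := by
  have e : ∀ m θ : ℝ, Real.sin θ ^ 2 * profileHeight κ m γ / (κ ^ 2 * profileHeight κ m θ ^ 3) =
      Real.sin θ ^ 2 / κ ^ 2 * (profileHeight κ m γ / profileHeight κ m θ ^ 3) :=
    fun m θ => by rw [div_mul_div_comm]
  refine intervalIntegral.integral_lt_integral_of_continuousOn_of_le_of_exists_lt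
    (by linarith) (continuous_profileVolume_integrand hκ (hm₁.trans h₁₂)).continuousOn
    (continuous_profileVolume_integrand hκ hm₁).continuousOn (fun θ hθ => ?_)
    -- One point of strict inequality suffices; sin vanishes at 0, and at γ when γ = π, but not at γ
    -- / 2.
    ⟨γ / 2, ⟨by linarith, by linarith⟩, ?_⟩
  · rw [e, e]
    have := profileHeight_div_cube_lt hκ hγπ hm₁ h₁₂ hθ.1.le hθ.2
    gcongr
  · rw [e, e]
    have := profileHeight_div_cube_lt hκ hγπ hm₁ h₁₂ (θ := γ / 2) (by linarith) (by linarith)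
    have hs : 0 < Real.sin (γ / 2) := Real.sin_pos_of_pos_of_lt_pi (by linarith) (by linarith)
    gcongr

theorem profileVolume_injOn (hκ : 0 < κ) (hγ : 0 < γ) (hγπ : γ ≤ Real.pi) :
    Set.InjOn (profileVolume κ γ) (Set.Ioi 0) := by
  have : StrictAntiOn (profileVolume κ γ) (Set.Ioi 0) :=
    fun _ h₁ _ _ h => profileVolume_lt hκ hγ hγπ h₁ h
  exact this.injOn

/-- The substitution m = exp t keeps m positive for all real t, so the intermediate value theorem
applies on the whole line. -/
theorem continuous_profileVolume_exp (hκ : 0 < κ) (γ : ℝ) :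
    Continuous fun t => profileVolume κ γ (Real.exp t) := by
  refine intervalIntegral.continuous_parametric_intervalIntegral_of_continuous'
    (f := fun t θ => Real.sin θ ^ 2 * profileHeight κ (Real.exp t) γ /
      (κ ^ 2 * profileHeight κ (Real.exp t) θ ^ 3)) ?_ _ _
  refine Continuous.div ?_ ?_ fun x => ?_
  · unfold profileHeight; fun_prop
  · unfold profileHeight; fun_prop
  · have := profileHeight_pos hκ (Real.exp_pos x.1) x.2
    positivity

/-- Decay for large m: once m ≥ 4 / κ, u(γ)² ≤ 2 m ≤ 2 u(θ)², so the integrand is at most 2 / (κ²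
m). -/
theorem profileVolume_le (hκ : 0 < κ) (hγ : 0 < γ) (hm : 4 / κ ≤ m) :
    profileVolume κ γ m ≤ 4 * γ / (κ ^ 2 * m) := by
  have hm0 : 0 < m := lt_of_lt_of_le (by positivity) hm
  have hb : ∀ θ, Real.sin θ ^ 2 * profileHeight κ m γ / (κ ^ 2 * profileHeight κ m θ ^ 3) ≤
      2 / (κ ^ 2 * m) := fun θ => by
    have p := profileHeight_pos hκ hm0 θ
    have g := profileHeight_pos hκ hm0 γ
    have q := sq_profileHeight hκ hm0 θ
    have r := sq_profileHeight hκ hm0 γ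
    have hmθ : m ≤ profileHeight κ m θ ^ 2 := by
      have : 0 ≤ 2 * (1 - Real.cos θ) / κ :=
        div_nonneg (by linarith [Real.cos_le_one θ]) hκ.le
      linarith
    have hmγ : profileHeight κ m γ ^ 2 ≤ 2 * m := by
      have : 2 * (1 - Real.cos γ) / κ ≤ 4 / κ := by
        gcongr; linarith [Real.neg_one_le_cos γ]
      linarith
    have hgp : profileHeight κ m γ ≤ 2 * profileHeight κ m θ := by nlinarith
    rw [div_le_div_iff₀ (by positivity) (by positivity)]
    have hs := Real.sin_sq_le_one θ
    calc Real.sin θ ^ 2 * profileHeight κ m γ * (κ ^ 2 * m)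
        ≤ 1 * (2 * profileHeight κ m θ) * (κ ^ 2 * profileHeight κ m θ ^ 2) := by gcongr
      _ = _ := by ring
  calc profileVolume κ γ m ≤ ∫ _ in (-γ)..γ, 2 / (κ ^ 2 * m) :=
        intervalIntegral.integral_mono_on (by linarith)
          ((continuous_profileVolume_integrand hκ hm0).intervalIntegrable _ _)
          (continuous_const.intervalIntegrable _ _) fun θ _ => hb θ
    _ = _ := by rw [intervalIntegral.integral_const, smul_eq_mul]; ring

/-- Logarithmic blow-up as m → 0: with m = ε² / κ and ε ≤ θ ≤ γ / 2 one has u(θ)² ≤ 2 θ² / κ and sin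
θ ≥ θ / 2, so the integrand is at least a constant times 1 / θ. -/
theorem le_profileVolume (hκ : 0 < κ) (hγ : 0 < γ) (hγπ : γ ≤ Real.pi) {ε : ℝ}
    (hε : 0 < ε) (hεγ : ε ≤ γ / 2) :
    √(2 * (1 - Real.cos γ) / κ) / (4 * κ ^ 2 * √(2 / κ) ^ 3) * Real.log (γ / 2 / ε) ≤
      profileVolume κ γ (ε ^ 2 / κ) := by
  have hm : 0 < ε ^ 2 / κ := by positivity
  have hb : ∀ θ ∈ Set.Icc ε (γ / 2),
      √(2 * (1 - Real.cos γ) / κ) / (4 * κ ^ 2 * √(2 / κ) ^ 3) * θ⁻¹ ≤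
      Real.sin θ ^ 2 * profileHeight κ (ε ^ 2 / κ) γ /
        (κ ^ 2 * profileHeight κ (ε ^ 2 / κ) θ ^ 3) := fun θ hθ => by
    have hθ0 : 0 < θ := hε.trans_le hθ.1
    have p := profileHeight_pos hκ hm θ
    have hsin : θ / 2 ≤ Real.sin θ := by
      refine le_trans ?_ (Real.mul_le_sin hθ0.le (by linarith [hθ.2]))
      rw [div_mul_eq_mul_div, div_le_div_iff₀ (by norm_num) Real.pi_pos]
      nlinarith [Real.pi_le_four]
    have hg : √(2 * (1 - Real.cos γ) / κ) ≤ profileHeight κ (ε ^ 2 / κ) γ :=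
      Real.sqrt_le_sqrt (by linarith)
    have hp : profileHeight κ (ε ^ 2 / κ) θ ≤ √(2 / κ) * θ := by
      refine (Real.sqrt_le_sqrt (y := 2 / κ * θ ^ 2) ?_).trans
        (by rw [Real.sqrt_mul (by positivity), Real.sqrt_sq hθ0.le])
      have hc := Real.one_sub_sq_div_two_le_cos (x := θ)
      rw [← add_div, div_mul_eq_mul_div]
      have := pow_le_pow_left₀ hε.le hθ.1 2
      gcongr
      linarith
    calc _ = (θ / 2) ^ 2 * √(2 * (1 - Real.cos γ) / κ) / (κ ^ 2 * (√(2 / κ) * θ) ^ 3) := by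
          field_simp; ring
      _ ≤ _ := by
          have := profileHeight_pos hκ hm γ
          gcongr
  have hcont := continuous_profileVolume_integrand (γ := γ) hκ hm
  calc _ = ∫ θ in ε..(γ / 2),
        √(2 * (1 - Real.cos γ) / κ) / (4 * κ ^ 2 * √(2 / κ) ^ 3) * θ⁻¹ := by
        rw [intervalIntegral.integral_const_mul, integral_inv_of_pos hε (by linarith)]
    _ ≤ ∫ θ in ε..(γ / 2), Real.sin θ ^ 2 * profileHeight κ (ε ^ 2 / κ) γ /
        (κ ^ 2 * profileHeight κ (ε ^ 2 / κ) θ ^ 3) := by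
        refine intervalIntegral.integral_mono_on hεγ ?_ (hcont.intervalIntegrable _ _) hb
        refine ContinuousOn.intervalIntegrable fun θ hθ => ?_
        rw [Set.uIcc_of_le hεγ] at hθ
        exact ((continuousAt_inv₀ (hε.trans_le hθ.1).ne').const_mul _).continuousWithinAt
    _ ≤ _ := by
        refine intervalIntegral.integral_mono_interval (by linarith) hεγ (by linarith)
          (Filter.Eventually.of_forall fun θ => ?_) (hcont.intervalIntegrable _ _)
        have := profileHeight_pos hκ hm θ
        have := profileHeight_pos hκ hm γ
        simp only [Pi.zero_apply]
        positivity

theorem exists_profileVolume_eq (hκ : 0 < κ) (hγ : 0 < γ) (hγπ : γ ≤ Real.pi) {V : ℝ}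
    (hV : 0 < V) : ∃ m, 0 < m ∧ profileVolume κ γ m = V := by
  obtain ⟨m₁, hm₁, h₁⟩ : ∃ m, 0 < m ∧ V ≤ profileVolume κ γ m := by
    set K := √(2 * (1 - Real.cos γ) / κ) / (4 * κ ^ 2 * √(2 / κ) ^ 3) with hK
    have hcos : Real.cos γ < 1 := by
      simpa using Real.cos_lt_cos_of_nonneg_of_le_pi le_rfl hγπ hγ
    have hK0 : 0 < K := by
      have : 0 < 2 * (1 - Real.cos γ) / κ := div_pos (by linarith) hκ
      have := Real.sqrt_pos.2 this
      positivity
    -- This ε solves K log (γ / 2 / ε) = V.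
    have hε : 0 < γ / 2 * Real.exp (-(V / K)) := by positivity
    refine ⟨_, div_pos (pow_pos hε 2) hκ, le_trans (le_of_eq ?_)
      (le_profileVolume hκ hγ hγπ hε ?_)⟩
    · rw [← hK, div_mul_cancel_left₀ (by positivity), ← Real.exp_neg, neg_neg, Real.log_exp]
      field_simp
    · have : Real.exp (-(V / K)) ≤ 1 := Real.exp_le_one_iff.2 (by simp; positivity)
      nlinarith
  obtain ⟨m₂, hm₂, h₂⟩ : ∃ m, 0 < m ∧ profileVolume κ γ m ≤ V := by
    have h0 : 0 < max (4 / κ) (4 * γ / (κ ^ 2 * V)) := lt_max_of_lt_left (by positivity)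
    refine ⟨_, h0, (profileVolume_le hκ hγ (le_max_left _ _)).trans ?_⟩
    have h := le_max_right (4 / κ) (4 * γ / (κ ^ 2 * V))
    rw [div_le_iff₀ (by positivity)] at h ⊢
    linarith
  obtain ⟨t, ht : profileVolume κ γ (Real.exp t) = V⟩ :=
    mem_range_of_exists_le_of_exists_ge (c := V) (continuous_profileVolume_exp hκ γ)
      ⟨Real.log m₂, by simpa only [Real.exp_log hm₂]⟩
      ⟨Real.log m₁, by simpa only [Real.exp_log hm₁]⟩
  exact ⟨_, Real.exp_pos t, ht⟩

end Profile

/-! ### Classification of planar profiles -/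

theorem eq_of_hasDerivAt_zero_Ioo {f : ℝ → ℝ} {a b : ℝ}
    (hf : ∀ s ∈ Set.Ioo a b, HasDerivAt f 0 s) {s t : ℝ} (hs : s ∈ Set.Ioo a b)
    (ht : t ∈ Set.Ioo a b) : f s = f t :=
  isOpen_Ioo.is_const_of_deriv_eq_zero isPreconnected_Ioo
    (fun u hu => (hf u hu).differentiableAt.differentiableWithinAt)
    (fun u hu => (hf u hu).deriv) hs ht

theorem eqOn_Icc_of_eqOn_Ioo {f g : ℝ → ℝ} {a b : ℝ} (hab : a < b)
    (hf : ContinuousOn f (Set.Icc a b)) (hg : ContinuousOn g (Set.Icc a b))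
    (h : Set.EqOn f g (Set.Ioo a b)) : Set.EqOn f g (Set.Icc a b) :=
  h.of_subset_closure hf hg Set.Ioo_subset_Icc_self (closure_Ioo hab.ne).ge

/-- A planar curve with velocity `(p, q)` and curvature `κ z` which meets the level `z = c` from
below at both ends at the angle `γ` is a profile, parametrized by its inclination `θ`. -/
theorem exists_inclination {κ a b c γ : ℝ} {x z p q : ℝ → ℝ} (hκ : 0 < κ) (hγ : 0 < γ)
    (hγπ : γ ≤ Real.pi) (hab : a < b)
    (cx : ContinuousOn x (Set.Icc a b)) (cz : ContinuousOn z (Set.Icc a b))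
    (cp : ContinuousOn p (Set.Icc a b))
    (dx : ∀ s ∈ Set.Ioo a b, HasDerivAt x (p s) s)
    (dz : ∀ s ∈ Set.Ioo a b, HasDerivAt z (q s) s)
    (dp : ∀ s ∈ Set.Ioo a b, HasDerivAt p (-(κ * z s * q s)) s)
    (dq : ∀ s ∈ Set.Ioo a b, HasDerivAt q (κ * z s * p s) s)
    (hpq : ∀ s ∈ Set.Ioo a b, p s ^ 2 + q s ^ 2 = 1)
    (za : z a = c) (zb : z b = c) (pa : p a = Real.cos γ) (pb : p b = Real.cos γ)
    (zpos : ∀ s ∈ Set.Ioo a b, 0 < z s) (zlt : ∀ s ∈ Set.Ioo a b, z s < c) :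
    ∃ (m x₀ : ℝ) (θ : ℝ → ℝ), 0 < m ∧ ContinuousOn θ (Set.Icc a b) ∧ θ a = -γ ∧ θ b = γ ∧
      (∀ s ∈ Set.Ioo a b, HasDerivAt θ (κ * profileHeight κ m (θ s)) s) ∧
      ∀ s ∈ Set.Icc a b, x s = x₀ + profileRadius κ m (θ s) ∧
        z s = profileHeight κ m (θ s) ∧ p s = Real.cos (θ s) := by
  obtain ⟨s₀, hs₀, hmin⟩ := isCompact_Icc.exists_isMinOn (Set.nonempty_Icc.2 hab.le) cz
  have hmid : (a + b) / 2 ∈ Set.Ioo a b := ⟨by linarith, by linarith⟩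
  have hs₀c : z s₀ < c := (hmin (Set.Ioo_subset_Icc_self hmid)).trans_lt (zlt _ hmid)
  have hs : s₀ ∈ Set.Ioo a b := by
    refine ⟨lt_of_le_of_ne hs₀.1 ?_, lt_of_le_of_ne hs₀.2 ?_⟩
    · rintro rfl; linarith
    · rintro rfl; linarith
  have q0 : q s₀ = 0 :=
    (hmin.isLocalMin (Icc_mem_nhds hs.1 hs.2)).hasDerivAt_eq_zero (dz s₀ hs)
  have hz0 := zpos s₀ hs
  -- The first integral of the capillary equation.
  have first : ∀ s ∈ Set.Icc a b, p s + κ * z s ^ 2 / 2 = p s₀ + κ * z s₀ ^ 2 / 2 := by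
    refine eqOn_Icc_of_eqOn_Ioo hab (cp.add ((continuousOn_const.mul (cz.pow 2)).div_const 2))
      continuousOn_const fun s hs' => ?_
    refine eq_of_hasDerivAt_zero_Ioo (f := fun s => p s + κ * z s ^ 2 / 2) (fun t ht => ?_) hs' hs
    refine ((dp t ht).add ((((dz t ht).pow 2).const_mul κ).div_const 2)).congr_deriv ?_
    push_cast; ring
  -- At the minimum p = ±1; comparing the first integral with the endpoint, where z is larger, gives
  -- p > cos γ ≥ -1.
  have p0 : p s₀ = 1 := by
    have h1 := hpq s₀ hs
    rw [q0] at h1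
    have h2 := first a ⟨le_rfl, hab.le⟩
    rw [za, pa] at h2
    have h3 : z s₀ ^ 2 < c ^ 2 := pow_lt_pow_left₀ hs₀c hz0.le two_ne_zero
    have h4 : κ * z s₀ ^ 2 < κ * c ^ 2 := mul_lt_mul_of_pos_left h3 hκ
    have h5 := Real.neg_one_le_cos γ
    nlinarith
  have hm : 0 < z s₀ ^ 2 := by positivity
  have hIcc : ∀ s ∈ Set.Icc a b, 0 < z s := fun s h => hz0.trans_le (hmin h)
  -- Extending z by constants makes θ differentiable on all of ℝ, endpoints included.
  set ζ : ℝ → ℝ := Set.IccExtend hab.le ((Set.Icc a b).domRestrict z) with hζ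
  have cζ : Continuous ζ := (continuousOn_iff_continuous_domRestrict.1 cz).Icc_extend'
  have ζz : ∀ s ∈ Set.Icc a b, ζ s = z s := fun s h => Set.IccExtend_of_mem _ _ h
  set θ : ℝ → ℝ := fun s => ∫ t in s₀..s, κ * ζ t with hθ
  have dθ : ∀ s, HasDerivAt θ (κ * ζ s) s := fun s =>
    ((continuous_const.mul cζ).integral_hasStrictDerivAt s₀ s).hasDerivAt
  have cθ : Continuous θ := continuous_iff_continuousAt.2 fun s => (dθ s).continuousAt
  have θ0 : θ s₀ = 0 := intervalIntegral.integral_same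
  -- The unit vectors (p, q) and (cos θ, sin θ) rotate at the same rate κ z and agree at s₀: their
  -- inner product stays 1, which forces equality.
  have hcos : ∀ s ∈ Set.Icc a b, p s = Real.cos (θ s) := by
    refine eqOn_Icc_of_eqOn_Ioo hab cp (Real.continuous_cos.comp cθ).continuousOn fun s h => ?_
    have hP : p s * Real.cos (θ s) + q s * Real.sin (θ s) =
        p s₀ * Real.cos (θ s₀) + q s₀ * Real.sin (θ s₀) := by
      refine eq_of_hasDerivAt_zero_Ioo
        (f := fun s => p s * Real.cos (θ s) + q s * Real.sin (θ s)) (fun t ht => ?_) h hs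
      refine (((dp t ht).mul (dθ t).cos).add ((dq t ht).mul (dθ t).sin)).congr_deriv ?_
      rw [ζz t (Set.Ioo_subset_Icc_self ht)]
      ring
    rw [p0, q0, θ0, Real.cos_zero] at hP
    have h1 := hpq s h
    have h2 := Real.sin_sq_add_cos_sq (θ s)
    nlinarith [sq_nonneg (q s - Real.sin (θ s)), sq_nonneg (p s - Real.cos (θ s))]
  have hz : ∀ s ∈ Set.Icc a b, z s = profileHeight κ (z s₀ ^ 2) (θ s) := fun s h => by
    rw [profileHeight, ← hcos s h, eq_comm, Real.sqrt_eq_iff_eq_sq _ (hIcc s h).le]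
    · have := first s h
      rw [p0] at this
      field_simp
      linarith
    · rw [hcos s h]
      exact (profileRadicand_pos hκ hm _).le
  have dθ' : ∀ s ∈ Set.Icc a b, HasDerivAt θ (κ * profileHeight κ (z s₀ ^ 2) (θ s)) s :=
    fun s h => by rw [← hz s h, ← ζz s h]; exact dθ s
  have mono : StrictMonoOn θ (Set.Icc a b) := by
    refine strictMonoOn_of_deriv_pos (convex_Icc a b) cθ.continuousOn fun s h => ?_
    rw [interior_Icc] at h
    rw [(dθ' s (Set.Ioo_subset_Icc_self h)).deriv]
    exact mul_pos hκ (profileHeight_pos hκ hm _)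
  have hab' : a ∈ Set.Icc a b ∧ b ∈ Set.Icc a b := ⟨⟨le_rfl, hab.le⟩, ⟨hab.le, le_rfl⟩⟩
  -- By the first integral, cos θ = cos γ would force z = c. So θ cannot cross ±γ in the interior,
  -- which confines its end values to a range where cos is injective.
  have hne : ∀ s ∈ Set.Ioo a b, Real.cos (θ s) ≠ Real.cos γ := fun s h e => by
    have h1 := first s (Set.Ioo_subset_Icc_self h)
    have h2 := first a hab'.1
    rw [hcos s (Set.Ioo_subset_Icc_self h), e, ← h2, pa, za] at h1
    have h3 : z s ^ 2 < c ^ 2 := pow_lt_pow_left₀ (zlt s h) (zpos s h).le two_ne_zero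
    have h4 : κ * z s ^ 2 < κ * c ^ 2 := mul_lt_mul_of_pos_left h3 hκ
    linarith
  have θb : θ b = γ := by
    have hpos : 0 < θ b := by rw [← θ0]; exact mono hs₀ hab'.2 hs.2
    have hle : θ b ≤ γ := by
      by_contra! hlt
      obtain ⟨s, h, e⟩ := intermediate_value_Ioo hs.2.le cθ.continuousOn
        (show γ ∈ Set.Ioo (θ s₀) (θ b) from ⟨by rwa [θ0], hlt⟩)
      exact hne s ⟨hs.1.trans h.1, h.2⟩ (by rw [e])
    exact Real.injOn_cos ⟨hpos.le, hle.trans hγπ⟩ ⟨hγ.le, hγπ⟩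
      (by rw [← hcos b hab'.2, pb])
  have θa : θ a = -γ := by
    have hpos : θ a < 0 := by rw [← θ0]; exact mono hab'.1 hs₀ hs.1
    have hle : -γ ≤ θ a := by
      by_contra! hlt
      obtain ⟨s, h, e⟩ := intermediate_value_Ioo hs.1.le cθ.continuousOn
        (show -γ ∈ Set.Ioo (θ a) (θ s₀) from ⟨hlt, by rw [θ0]; linarith⟩)
      exact hne s ⟨h.1, h.2.trans hs.2⟩ (by rw [e, Real.cos_neg])
    have : -θ a = γ := Real.injOn_cos ⟨by linarith, by linarith⟩ ⟨hγ.le, hγπ⟩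
      (by rw [Real.cos_neg, ← hcos a hab'.1, pa])
    linarith
  have hX : ∀ s ∈ Set.Icc a b, x s = x s₀ + profileRadius κ (z s₀ ^ 2) (θ s) := by
    have cX : Continuous (profileRadius κ (z s₀ ^ 2)) :=
      continuous_iff_continuousAt.2 fun t => (hasDerivAt_profileRadius hκ hm t).continuousAt
    refine eqOn_Icc_of_eqOn_Ioo hab cx (continuous_const.add (cX.comp cθ)).continuousOn
      fun s h => ?_
    have : x s - profileRadius κ (z s₀ ^ 2) (θ s) =
        x s₀ - profileRadius κ (z s₀ ^ 2) (θ s₀) := by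
      refine eq_of_hasDerivAt_zero_Ioo
        (f := fun s => x s - profileRadius κ (z s₀ ^ 2) (θ s)) (fun t ht => ?_) h hs
      have ht' := Set.Ioo_subset_Icc_self ht
      refine ((dx t ht).sub
        ((hasDerivAt_profileRadius hκ hm (θ t)).comp t (dθ' t ht'))).congr_deriv ?_
      have := profileHeight_pos hκ hm (θ t)
      rw [hcos t ht']
      field_simp
      ring
    have h0 : profileRadius κ (z s₀ ^ 2) (θ s₀) = 0 := by
      rw [θ0]; exact intervalIntegral.integral_same
    linarith
  exact ⟨z s₀ ^ 2, x s₀, θ, hm, cθ.continuousOn, θa, θb,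
    fun s h => dθ' s (Set.Ioo_subset_Icc_self h), fun s h => ⟨hX s h, hz s h, hcos s h⟩⟩

theorem integral_profile {κ m γ a b : ℝ} {θ : ℝ → ℝ} (hκ : 0 < κ) (hm : 0 < m) (hab : a < b)
    (cθ : ContinuousOn θ (Set.Icc a b)) (θa : θ a = -γ) (θb : θ b = γ)
    (dθ : ∀ s ∈ Set.Ioo a b, HasDerivAt θ (κ * profileHeight κ m (θ s)) s) :
    ∫ s in a..b, (profileHeight κ m γ - profileHeight κ m (θ s)) * Real.cos (θ s) =
      profileVolume κ γ m := by
  have hI := continuous_profileVolume_integrand (γ := γ) hκ hm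
  -- An antiderivative in the inclination, found by integration by parts; its boundary term vanishes
  -- at φ = ±γ because u is even.
  set F : ℝ → ℝ := fun φ => (profileHeight κ m γ / profileHeight κ m φ - 1) * Real.sin φ / κ +
    ∫ τ in (-γ)..φ, Real.sin τ ^ 2 * profileHeight κ m γ /
      (κ ^ 2 * profileHeight κ m τ ^ 3) with hF
  have dF : ∀ φ, HasDerivAt F ((profileHeight κ m γ - profileHeight κ m φ) * Real.cos φ /
      (κ * profileHeight κ m φ)) φ := fun φ => by
    have hp := profileHeight_pos hκ hm φ
    have h1 := (((hasDerivAt_const φ (profileHeight κ m γ)).div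
      (hasDerivAt_profileHeight hκ hm φ) hp.ne').sub_const 1).mul (Real.hasDerivAt_sin φ)
    refine ((h1.div_const κ).add (hI.integral_hasStrictDerivAt (-γ) φ).hasDerivAt).congr_deriv ?_
    simp only [Pi.div_apply]
    field_simp
    ring
  have cF : Continuous F := continuous_iff_continuousAt.2 fun φ => (dF φ).continuousAt
  have cI : ContinuousOn
      (fun s => (profileHeight κ m γ - profileHeight κ m (θ s)) * Real.cos (θ s))
      (Set.Icc a b) :=
    (continuousOn_const.sub ((continuous_profileHeight κ m).comp_continuousOn cθ)).mul
      (Real.continuous_cos.comp_continuousOn cθ)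
  rw [intervalIntegral.integral_eq_sub_of_hasDerivAt_of_le hab.le (f := fun s => F (θ s))
    (cF.comp_continuousOn cθ) (fun s hs => ?_)
    (ContinuousOn.intervalIntegrable (by rwa [Set.uIcc_of_le hab.le]))]
  · have hp := profileHeight_pos hκ hm γ
    simp only [hF, θa, θb, intervalIntegral.integral_same, profileHeight_neg, div_self hp.ne']
    rw [profileVolume]
    ring
  · refine ((dF (θ s)).comp s (dθ s hs)).congr_deriv ?_
    have hp := profileHeight_pos hκ hm (θ s)
    field_simp

/-! ### Reduction of a resting surface to its profile -/

theorem inner_E3 (u v : E3) : ⟪u, v⟫_ℝ = u 0 * v 0 + u 1 * v 1 + u 2 * v 2 := by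
  simp [PiLp.inner_apply, Fin.sum_univ_three, mul_comm]

theorem HasDerivAt.coord {f : ℝ → E3} {f' : E3} {s : ℝ} (h : HasDerivAt f f' s) (i : Fin 3) :
    HasDerivAt (fun s => f s i) (f' i) s :=
  ((EuclideanSpace.proj (𝕜 := ℝ) i).hasFDerivAt.comp_hasDerivAt s h :)

/-- Here E = G = 1 and F = 0, and the rulings contribute nothing to the second fundamental form, so
2H is the signed curvature of the directrix. -/
theorem meanCurvature_ruledPoint {α : ℝ → E3} {w N : E3} {s : ℝ} (hα : ‖deriv α s‖ = 1)
    (hw : ‖w‖ = 1) (hαw : ⟪deriv α s, w⟫_ℝ = 0) (t : ℝ) :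
    2 * meanCurvature (ruledPoint α w) N s t = ⟪deriv (deriv α) s, N⟫_ℝ := by
  have h1 : ∀ σ τ, deriv (fun σ' => ruledPoint α w σ' τ) σ = deriv α σ := fun σ τ => by
    simp [ruledPoint]
  have h2 : ∀ σ τ, deriv (fun τ' => ruledPoint α w σ τ') τ = w := fun σ τ => by
    have := (((hasDerivAt_id τ).smul_const w).const_add (α σ)).deriv
    rwa [one_smul] at this
  simp only [meanCurvature, h1, h2, deriv_const, inner_zero_left, hαw, real_inner_self_eq_norm_sq,
    hα, hw]
  change 2 * ((⟪deriv (deriv α) s, N⟫_ℝ * _ - _ + _) / _) = _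
  ring

/-- The effect of an orthonormal frame `(a, q), (n, p)` of the plane on a vector `(A, B)`. -/
theorem planar_frame {a q n p A B k : ℝ} (haq : a ^ 2 + q ^ 2 = 1) (hnp : n ^ 2 + p ^ 2 = 1)
    (h0 : n * a + p * q = 0) (hA : a * A + q * B = 0) (hk : A * n + B * p = k) :
    (a * p - n * q) ^ 2 = 1 ∧ p = (a * p - n * q) * a ∧
      (a * p - n * q) * A = -(k * q) ∧ B = k * p := by
  have hn : n = -((a * p - n * q) * q) := by linear_combination (-n) * haq + a * h0
  have hp : p = (a * p - n * q) * a := by linear_combination (-p) * haq + q * h0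
  have he : (a * p - n * q) ^ 2 = 1 := by
    linear_combination haq * (n ^ 2 + p ^ 2) + hnp - h0 * (n * a + p * q)
  refine ⟨he, hp, ?_, ?_⟩
  · generalize a * p - n * q = ε at *
    subst hn hp
    linear_combination (-ε * A) * haq + ε * a * hA - q * hk
  · generalize a * p - n * q = ε at *
    subst hn hp
    subst hk
    linear_combination (-B) * haq + (q) * hA - (a ^ 2 * B - a * q * A) * he

/-- The cylinder over the profile with lowest height `√m`, cut off at the inclination `γ`. -/
def profileCylinder (κ γ m : ℝ) : Set E3 :=
  {p | ∃ φ ∈ Set.Icc (-γ) γ, p 0 = profileRadius κ m φ ∧ p 2 = profileHeight κ m φ}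

/-- The height-preserving isometry which takes the horizontal unit vector `(u, v, 0)` to the
second coordinate axis. -/
def horizontalIsometry (u v ε d : ℝ) (huv : u ^ 2 + v ^ 2 = 1) (hε : ε ^ 2 = 1) : E3 ≃ᵢ E3 where
  toFun p := !₂[ε * (p 0 * v - p 1 * u) - d, p 0 * u + p 1 * v, p 2]
  invFun p := !₂[ε * (p 0 + d) * v + p 1 * u, -(ε * (p 0 + d) * u) + p 1 * v, p 2]
  left_inv p := by
    ext i
    fin_cases i
    · simp
      linear_combination (p 0 * v ^ 2 - p 1 * u * v) * hε + p 0 * huv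
    · simp
      linear_combination (-p 0 * u * v + p 1 * u ^ 2) * hε + p 1 * huv
    · simp
  right_inv p := by
    ext i
    fin_cases i
    · simp
      linear_combination (p 0 + d) * (u ^ 2 + v ^ 2) * hε + (p 0 + d) * huv
    · simp
      linear_combination p 1 * huv
    · simp
  isometry_toFun := by
    refine Isometry.of_dist_eq fun p q => ?_
    simp only [EuclideanSpace.dist_eq, Fin.sum_univ_three, Real.dist_eq, sq_abs]
    congr 1
    simp
    linear_combination ((p 0 - q 0) * v - (p 1 - q 1) * u) ^ 2 * hε +
      ((p 0 - q 0) ^ 2 + (p 1 - q 1) ^ 2) * huv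

theorem CylindricalSurface.RestsOn.exists_profile {κ c γ : ℝ} (hκ : 0 < κ) (hγ : 0 < γ)
    (hγπ : γ ≤ Real.pi) {S : CylindricalSurface κ} (h : S.RestsOn c γ) :
    ∃ m, 0 < m ∧ c = profileHeight κ m γ ∧ S.volume c = profileVolume κ γ m ∧
      ∃ g : E3 ≃ᵢ E3, (∀ p, (g p) 2 = p 2) ∧ g '' S.carrier = profileCylinder κ γ m := by
  have hr : ∀ s t, (ruledPoint S.α S.w s t) 2 = S.α s 2 + t * S.w 2 := fun s t => by
    simp [ruledPoint]
  -- A whole ruling lies in a horizontal plane.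
  have hw2 : S.w 2 = 0 := by
    have h0 := h.boundary_left 0
    have h1 := h.boundary_left 1
    rw [hr] at h0 h1
    linarith
  have hr : ∀ s t, (ruledPoint S.α S.w s t) 2 = S.α s 2 := fun s t => by
    rw [hr, hw2, mul_zero, add_zero]
  have hw : S.w 0 ^ 2 + S.w 1 ^ 2 = 1 := by
    have := real_inner_self_eq_norm_sq S.w
    rw [S.norm_w, inner_E3, hw2] at this
    linarith
  have hα2 := (contDiffOn_succ_iff_deriv_of_isOpen (n := 1) isOpen_Ioo).1
    (by simpa [one_add_one_eq_two] using S.contDiffOn_α)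
  have dα : ∀ s ∈ Set.Ioo S.a S.b, HasDerivAt S.α (deriv S.α s) s := fun s hs =>
    (hα2.1.differentiableAt (isOpen_Ioo.mem_nhds hs)).hasDerivAt
  have dα' : ∀ s ∈ Set.Ioo S.a S.b, HasDerivAt (deriv S.α) (deriv (deriv S.α) s) s :=
    fun s hs => ((hα2.2.2.differentiableOn one_ne_zero).differentiableAt
      (isOpen_Ioo.mem_nhds hs)).hasDerivAt
  have hvv : ∀ s ∈ Set.Ioo S.a S.b, ⟪deriv S.α s, deriv S.α s⟫_ℝ = 1 := fun s hs => by
    rw [real_inner_self_eq_norm_sq, S.norm_deriv_α s hs, one_pow]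
  have hvA : ∀ s ∈ Set.Ioo S.a S.b, ⟪deriv S.α s, deriv (deriv S.α) s⟫_ℝ = 0 := fun s hs => by
    have h1 := (dα' s hs).inner ℝ (dα' s hs)
    have h2 : HasDerivAt (fun s => ⟪deriv S.α s, deriv S.α s⟫_ℝ) 0 s :=
      (hasDerivAt_const s (1 : ℝ)).congr_of_eventuallyEq
        (Filter.eventuallyEq_of_mem (isOpen_Ioo.mem_nhds hs) hvv)
    have h3 := h1.unique h2
    rw [real_inner_comm (deriv S.α s)] at h3
    linarith
  have hwA : ∀ s ∈ Set.Ioo S.a S.b, ⟪deriv (deriv S.α) s, S.w⟫_ℝ = 0 := fun s hs => by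
    have h1 := (dα' s hs).inner ℝ (hasDerivAt_const s S.w)
    have h2 : HasDerivAt (fun s => ⟪deriv S.α s, S.w⟫_ℝ) 0 s :=
      (hasDerivAt_const s (0 : ℝ)).congr_of_eventuallyEq
        (Filter.eventuallyEq_of_mem (isOpen_Ioo.mem_nhds hs) S.inner_deriv_α_w)
    have h3 := h1.unique h2
    rwa [inner_zero_right, zero_add] at h3
  -- components along the horizontal direction orthogonal to the rulings
  set hor : E3 → ℝ := fun v => v 0 * S.w 1 - v 1 * S.w 0 with hhor
  have hsplit : ∀ u v : E3, ⟪u, S.w⟫_ℝ = 0 → ⟪u, v⟫_ℝ = hor u * hor v + u 2 * v 2 := by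
    intro u v hu
    rw [inner_E3, hw2] at hu
    rw [inner_E3]
    simp only [hhor]
    linear_combination (-(u 0 * v 0 + u 1 * v 1)) * hw + (v 0 * S.w 0 + v 1 * S.w 1) * hu
  -- The orientation sign of the frame (α', N) in the plane orthogonal to the rulings. It is
  -- continuous with square 1, hence constant; thus N is as smooth as α', although only its
  -- continuity is assumed.
  set ε : ℝ → ℝ := fun s => hor (deriv S.α s) * S.N s 2 - hor (S.N s) * deriv S.α s 2 with hε
  have key : ∀ s ∈ Set.Ioo S.a S.b, ε s ^ 2 = 1 ∧ S.N s 2 = ε s * hor (deriv S.α s) ∧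
      ε s * hor (deriv (deriv S.α) s) = -(κ * S.α s 2 * deriv S.α s 2) ∧
      deriv (deriv S.α) s 2 = κ * S.α s 2 * S.N s 2 := fun s hs => by
    have hv := S.inner_deriv_α_w s hs
    have e1 := hvv s hs
    have e2 := real_inner_self_eq_norm_sq (S.N s)
    have e3 := S.inner_N_deriv_α s hs
    have e4 := hvA s hs
    have e5 := S.capillary s hs 0
    rw [S.norm_N s hs] at e2
    rw [meanCurvature_ruledPoint (S.norm_deriv_α s hs) S.norm_w hv, hr] at e5
    rw [hsplit _ _ hv] at e1 e4
    rw [hsplit _ _ (S.inner_N_w s hs)] at e2 e3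
    rw [hsplit _ _ (hwA s hs)] at e5
    exact planar_frame (by linarith) (by linarith) e3 e4 e5
  have chor : Continuous hor := by simp only [hhor]; fun_prop
  have c2 : Continuous fun v : E3 => v 2 := by fun_prop
  have cα' : ContinuousOn (deriv S.α) (Set.Ioo S.a S.b) :=
    fun s hs => (dα' s hs).continuousAt.continuousWithinAt
  have cN : ContinuousOn S.N (Set.Ioo S.a S.b) := S.continuousOn_N.mono Set.Ioo_subset_Icc_self
  have cε : ContinuousOn ε (Set.Ioo S.a S.b) :=
    ((chor.comp_continuousOn cα').mul (c2.comp_continuousOn cN)).sub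
      ((chor.comp_continuousOn cN).mul (c2.comp_continuousOn cα'))
  obtain ⟨δ, hδ, hεδ⟩ : ∃ δ : ℝ, δ ^ 2 = 1 ∧ ∀ s ∈ Set.Ioo S.a S.b, ε s = δ := by
    rcases isPreconnected_Ioo.eq_or_eq_neg_of_sq_eq cε continuousOn_const
      (g := fun _ => (1 : ℝ)) (fun s hs => by simpa using (key s hs).1) (fun _ => one_ne_zero)
      with h1 | h1
    · exact ⟨1, by norm_num, fun s hs => h1 hs⟩
    · exact ⟨-1, by norm_num, fun s hs => h1 hs⟩
  have dhor : ∀ {f : ℝ → E3} {f' : E3} {s : ℝ}, HasDerivAt f f' s →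
      HasDerivAt (fun s => hor (f s)) (hor f') s := fun hf =>
    ((hf.coord 0).mul_const _).sub ((hf.coord 1).mul_const _)
  have dp : ∀ s ∈ Set.Ioo S.a S.b,
      HasDerivAt (fun s => S.N s 2) (-(κ * S.α s 2 * deriv S.α s 2)) s := fun s hs => by
    have h1 := (dhor (dα' s hs)).const_mul δ
    rw [← (key s hs).2.2.1, hεδ s hs]
    refine h1.congr_of_eventuallyEq (Filter.eventuallyEq_of_mem (isOpen_Ioo.mem_nhds hs) ?_)
    intro t ht
    change S.N t 2 = δ * hor (deriv S.α t)
    rw [← hεδ t ht]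
    exact (key t ht).2.1
  obtain ⟨m, x₀, θ, hm, cθ, θa, θb, dθ, hθ⟩ := exists_inclination (κ := κ) (c := c)
    (x := fun s => δ * hor (S.α s)) (z := fun s => S.α s 2) (p := fun s => S.N s 2)
    (q := fun s => deriv S.α s 2) hκ hγ hγπ S.a_lt_b
    (continuousOn_const.mul (chor.comp_continuousOn S.continuousOn_α))
    (c2.comp_continuousOn S.continuousOn_α) (c2.comp_continuousOn S.continuousOn_N)
    (fun s hs => by
      rw [(key s hs).2.1, hεδ s hs]
      exact (dhor (dα s hs)).const_mul δ)
    (fun s hs => (dα s hs).coord 2) dp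
    (fun s hs => by
      rw [← (key s hs).2.2.2]
      exact (dα' s hs).coord 2)
    (fun s hs => by
      have e := hvv s hs
      rw [hsplit _ _ (S.inner_deriv_α_w s hs)] at e
      have k := key s hs
      rw [k.2.1, mul_pow, k.1]
      linarith)
    (by rw [← hr S.a 0]; exact h.boundary_left 0) (by rw [← hr S.b 0]; exact h.boundary_right 0)
    h.angle_left h.angle_right
    (fun s hs => by rw [← hr s 0]; exact h.height_pos s hs 0)
    (fun s hs => by rw [← hr s 0]; exact h.height_lt s hs 0)
  have hc : c = profileHeight κ m γ := by
    rw [← h.boundary_right 0, hr, (hθ S.b ⟨S.a_lt_b.le, le_rfl⟩).2.1, θb]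
  have hαw : ∀ s ∈ Set.Icc S.a S.b, S.α s 0 * S.w 0 + S.α s 1 * S.w 1 =
      S.α ((S.a + S.b) / 2) 0 * S.w 0 + S.α ((S.a + S.b) / 2) 1 * S.w 1 := by
    have cα : ContinuousOn (fun s => S.α s 0 * S.w 0 + S.α s 1 * S.w 1) (Set.Icc S.a S.b) := by
      have : Continuous fun v : E3 => v 0 * S.w 0 + v 1 * S.w 1 := by fun_prop
      exact this.comp_continuousOn S.continuousOn_α
    have := S.a_lt_b
    refine eqOn_Icc_of_eqOn_Ioo this cα continuousOn_const fun s hs => ?_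
    refine eq_of_hasDerivAt_zero_Ioo (f := fun s => S.α s 0 * S.w 0 + S.α s 1 * S.w 1)
      (fun t ht => ?_) hs ⟨by linarith, by linarith⟩
    refine ((((dα t ht).coord 0).mul_const _).add
      (((dα t ht).coord 1).mul_const _)).congr_deriv ?_
    have := S.inner_deriv_α_w t ht
    rw [inner_E3, hw2] at this
    linarith
  -- The isometry makes the rulings parallel to the second axis, with δ correcting the orientation
  -- and x₀ moving the lowest line to first coordinate 0.
  refine ⟨m, hm, hc, ?_, horizontalIsometry (S.w 0) (S.w 1) δ x₀ hw hδ, fun p => rfl, ?_⟩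
  · rw [CylindricalSurface.volume, hc, ← integral_profile hκ hm S.a_lt_b cθ θa θb dθ]
    refine intervalIntegral.integral_congr fun s hs => ?_
    rw [Set.uIcc_of_le S.a_lt_b.le] at hs
    simp only [(hθ s hs).2.1, (hθ s hs).2.2]
  · ext p
    constructor
    · rintro ⟨_, ⟨s, hs, t, rfl⟩, rfl⟩
      refine ⟨θ s, ?_, ?_, ?_⟩
      · have : MonotoneOn θ (Set.Icc S.a S.b) := by
          refine monotoneOn_of_deriv_nonneg (convex_Icc _ _) cθ (fun t ht => ?_) fun t ht => ?_
          all_goals rw [interior_Icc] at ht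
          · exact (dθ t ht).differentiableAt.differentiableWithinAt
          · rw [(dθ t ht).deriv]
            exact (mul_pos hκ (profileHeight_pos hκ hm _)).le
        rw [← θa, ← θb]
        exact ⟨this ⟨le_rfl, S.a_lt_b.le⟩ hs hs.1, this hs ⟨S.a_lt_b.le, le_rfl⟩ hs.2⟩
      · have := (hθ s hs).1
        simp only [hhor] at this
        simp [horizontalIsometry, ruledPoint]
        linarith
      · rw [← (hθ s hs).2.1]
        exact hr s t
    · rintro ⟨φ, hφ, h0, h2⟩
      rw [← θa, ← θb] at hφ
      obtain ⟨s, hs, rfl⟩ := intermediate_value_Icc S.a_lt_b.le cθ hφ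
      -- Since `S.w` is a unit vector, this ruling parameter gives the image point second coordinate
      -- `p 1`.
      refine ⟨_, ⟨s, hs, p 1 - (S.α s 0 * S.w 0 + S.α s 1 * S.w 1), rfl⟩, ?_⟩
      have h3 := hθ s hs
      simp only [hhor] at h3
      ext i
      fin_cases i
      · simp [horizontalIsometry, ruledPoint, h0]
        linarith
      · simp [horizontalIsometry, ruledPoint]
        linear_combination (p 1 - (S.α s 0 * S.w 0 + S.α s 1 * S.w 1)) * hw
      · refine Eq.trans (hr s _) ?_
        rw [h3.2.1]
        exact h2.symm

/-! ### Construction of the surface for given m -/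

theorem exists_inclination_of_arclength {κ m : ℝ} (hκ : 0 < κ) (hm : 0 < m) :
    ∃ Θ : ℝ → ℝ, StrictMono Θ ∧ (∀ s, HasDerivAt Θ (κ * profileHeight κ m (Θ s)) s) ∧
      ∀ φ, Θ (profileLength κ m φ) = φ := by
  have dT := hasDerivAt_profileLength hκ hm
  have cT : Continuous (profileLength κ m) :=
    continuous_iff_continuousAt.2 fun θ => (dT θ).continuousAt
  have mono : StrictMono (profileLength κ m) := by
    refine strictMono_of_deriv_pos fun θ => ?_
    rw [(dT θ).deriv]
    have := profileHeight_pos hκ hm θ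
    positivity
  have hT0 : profileLength κ m 0 = 0 := intervalIntegral.integral_same
  -- The height is largest at inclination π, so k bounds the derivative of arc length from below.
  -- Arc length is therefore a bijection of ℝ, and Θ is its inverse.
  set k : ℝ := 1 / (κ * profileHeight κ m Real.pi) with hk
  have hk0 : 0 < k := by
    have := profileHeight_pos hκ hm Real.pi
    positivity
  have hmono : Monotone fun θ => profileLength κ m θ - k * θ := by
    have hd : ∀ θ, HasDerivAt (fun θ => profileLength κ m θ - k * θ)
        (1 / (κ * profileHeight κ m θ) - k * 1) θ := fun θ =>
      (dT θ).sub ((hasDerivAt_id θ).const_mul k)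
    refine monotone_of_deriv_nonneg (fun θ => (hd θ).differentiableAt) fun θ => ?_
    rw [(hd θ).deriv, mul_one, sub_nonneg, hk]
    have h1 := profileHeight_pos hκ hm θ
    have h2 : profileHeight κ m θ ≤ profileHeight κ m Real.pi := by
      refine Real.sqrt_le_sqrt ?_
      have := Real.neg_one_le_cos θ
      rw [Real.cos_pi]
      gcongr
    gcongr
  have surj : Function.Surjective (profileLength κ m) := by
    refine cT.surjective ?_ ?_
    · refine Filter.tendsto_atTop_mono' _ ?_ (Filter.tendsto_id.const_mul_atTop hk0)
      filter_upwards [Filter.eventually_ge_atTop 0] with θ hθ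
      have := hmono hθ
      simp only [hT0, id] at this ⊢
      linarith
    · refine Filter.tendsto_atBot_mono' _ ?_ (Filter.tendsto_id.const_mul_atBot hk0)
      filter_upwards [Filter.eventually_le_atBot 0] with θ hθ
      have := hmono hθ
      simp only [hT0, id] at this ⊢
      linarith
  let T := mono.orderIsoOfSurjective _ surj
  refine ⟨T.symm, T.symm.strictMono, fun s => ?_, fun φ => T.symm_apply_apply φ⟩
  have hp := profileHeight_pos hκ hm (T.symm s)
  refine ((dT (T.symm s)).of_local_left_inverse T.symm.continuous.continuousAt (by positivity)
    (Filter.Eventually.of_forall fun y => T.apply_symm_apply y)).congr_deriv ?_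
  rw [one_div, inv_inv]

theorem exists_cylindricalSurface {κ m γ : ℝ} (hκ : 0 < κ) (hm : 0 < m) (hγ : 0 < γ)
    (hγπ : γ ≤ Real.pi) : ∃ S : CylindricalSurface κ, S.RestsOn (profileHeight κ m γ) γ ∧
      S.volume (profileHeight κ m γ) = profileVolume κ γ m := by
  obtain ⟨Θ, mono, dΘ, hΘ⟩ := exists_inclination_of_arclength hκ hm
  have hab : profileLength κ m (-γ) < profileLength κ m γ := by
    rw [← mono.lt_iff_lt, hΘ, hΘ]
    linarith
  have hmem : ∀ s ∈ Set.Ioo (profileLength κ m (-γ)) (profileLength κ m γ),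
      -γ < Θ s ∧ Θ s < γ := fun s hs => by
    have h := And.intro (mono hs.1) (mono hs.2)
    rwa [hΘ, hΘ] at h
  have cΘ : Continuous Θ := continuous_iff_continuousAt.2 fun s => (dΘ s).continuousAt
  let e : Fin 3 → E3 := fun i => EuclideanSpace.single i 1
  let α : ℝ → E3 := fun s => profileRadius κ m (Θ s) • e 0 + profileHeight κ m (Θ s) • e 2
  let N : ℝ → E3 := fun s => (-Real.sin (Θ s)) • e 0 + Real.cos (Θ s) • e 2
  have dα : ∀ s, HasDerivAt α (Real.cos (Θ s) • e 0 + Real.sin (Θ s) • e 2) s := fun s => by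
    have hp := profileHeight_pos hκ hm (Θ s)
    have h1 : HasDerivAt (fun s => profileRadius κ m (Θ s)) (Real.cos (Θ s)) s :=
      ((hasDerivAt_profileRadius hκ hm (Θ s)).comp s (dΘ s)).congr_deriv (by field_simp)
    have h2 : HasDerivAt (fun s => profileHeight κ m (Θ s)) (Real.sin (Θ s)) s :=
      ((hasDerivAt_profileHeight hκ hm (Θ s)).comp s (dΘ s)).congr_deriv (by field_simp)
    exact (h1.smul_const _).add (h2.smul_const _)
  have hα : deriv α = fun s => Real.cos (Θ s) • e 0 + Real.sin (Θ s) • e 2 :=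
    funext fun s => (dα s).deriv
  -- The tangent turns towards N at the rate Θ' = κ u, which is the capillary equation.
  have dα' : ∀ s, HasDerivAt (deriv α) ((κ * profileHeight κ m (Θ s)) • N s) s := fun s => by
    rw [hα]
    refine (((dΘ s).cos.smul_const (e 0)).add ((dΘ s).sin.smul_const (e 2))).congr_deriv ?_
    simp only [N, smul_add, smul_smul]
    congr 2 <;> ring
  have hα' : deriv (deriv α) = fun s => (κ * profileHeight κ m (Θ s)) • N s :=
    funext fun s => (dα' s).deriv
  have cN : Continuous N := by fun_prop
  have hα2 : ContDiff ℝ 2 α := by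
    refine contDiff_succ_iff_deriv (n := 1).2 ⟨fun s => (dα s).differentiableAt, by simp, contDiff_one_iff_deriv.2
      ⟨fun s => (dα' s).differentiableAt, ?_⟩⟩
    rw [hα']
    exact (continuous_const.mul ((continuous_profileHeight κ m).comp cΘ)).smul cN
  have hα_norm : ∀ s, ‖deriv α s‖ = 1 := fun s => by
    rw [← sq_eq_sq₀ (norm_nonneg _) zero_le_one, ← real_inner_self_eq_norm_sq, inner_E3, hα]
    simp [e]
    linarith [Real.sin_sq_add_cos_sq (Θ s)]
  have hN_norm : ∀ s, ‖N s‖ = 1 := fun s => by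
    rw [← sq_eq_sq₀ (norm_nonneg _) zero_le_one, ← real_inner_self_eq_norm_sq, inner_E3]
    simp [e, N]
    linarith [Real.sin_sq_add_cos_sq (Θ s)]
  have hαw : ∀ s, ⟪deriv α s, e 1⟫_ℝ = 0 := fun s => by
    rw [inner_E3, hα]
    simp [e]
  have hw : ‖e 1‖ = 1 := by simp [e]
  have hz : ∀ s t, (ruledPoint α (e 1) s t) 2 = profileHeight κ m (Θ s) := fun s t => by
    simp [ruledPoint, α, e]
  let S : CylindricalSurface κ :=
    { a := profileLength κ m (-γ)
      b := profileLength κ m γ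
      a_lt_b := hab
      w := e 1
      norm_w := hw
      α := α
      continuousOn_α := hα2.continuous.continuousOn
      contDiffOn_α := hα2.contDiffOn
      norm_deriv_α := fun s _ => hα_norm s
      inner_deriv_α_w := fun s _ => hαw s
      N := N
      continuousOn_N := cN.continuousOn
      norm_N := fun s _ => hN_norm s
      inner_N_deriv_α := fun s _ => by
        rw [inner_E3, hα]
        simp [e, N]
        ring
      inner_N_w := fun s _ => by
        rw [inner_E3]
        simp [e, N]
      capillary := fun s _ t => by
        rw [meanCurvature_ruledPoint (hα_norm s) hw (hαw s), hα', hz, real_inner_smul_left,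
          real_inner_self_eq_norm_sq, hN_norm]
        ring }
  have hNz : ∀ s, (N s) 2 = Real.cos (Θ s) := fun s => by simp [N, e]
  refine ⟨S, ⟨fun t => ?_, fun t => ?_, fun s _ t => ?_, fun s hs t => ?_, ?_, ?_⟩, ?_⟩
  · refine (hz _ t).trans ?_
    rw [hΘ, profileHeight_neg]
  · refine (hz _ t).trans ?_
    rw [hΘ]
  · exact (profileHeight_pos hκ hm _).trans_eq (hz s t).symm
  · exact (hz s t).trans_lt (profileHeight_lt hκ hm hγπ (hmem s hs).1 (hmem s hs).2)
  · refine (hNz _).trans ?_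
    rw [hΘ, Real.cos_neg]
  · refine (hNz _).trans ?_
    rw [hΘ]
  · rw [CylindricalSurface.volume, ← integral_profile hκ hm hab cΘ.continuousOn (hΘ _) (hΘ _)
      fun s _ => dΘ s]
    refine intervalIntegral.integral_congr fun s _ => ?_
    have : (α s) 2 = profileHeight κ m (Θ s) := by simp [α, e]
    simp only [S, hNz, this]

end

/-! ### Existence and uniqueness -/

theorem mainTheorem1 (κ V γ : ℝ) (hκ : 0 < κ) (hV : 0 < V) (hγ : 0 < γ) (hγπ : γ ≤ Real.pi) :
    ∃ (S : CylindricalSurface κ) (c : ℝ), S.RestsOn c γ ∧ S.volume c = V ∧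
      ∀ (S' : CylindricalSurface κ) (c' : ℝ), S'.RestsOn c' γ → S'.volume c' = V →
        c' = c ∧ ∃ g : E3 ≃ᵢ E3, (∀ p : E3, (g p) 2 = p 2) ∧ g '' S.carrier = S'.carrier := by
  obtain ⟨m, hm, hmV⟩ := exists_profileVolume_eq hκ hγ hγπ hV
  obtain ⟨S, hS, hSV⟩ := exists_cylindricalSurface hκ hm hγ hγπ
  have unique : ∀ (S' : CylindricalSurface κ) (c' : ℝ), S'.RestsOn c' γ → S'.volume c' = V →
      c' = profileHeight κ m γ ∧ ∃ g : E3 ≃ᵢ E3, (∀ p : E3, (g p) 2 = p 2) ∧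
        g '' S'.carrier = profileCylinder κ γ m := by
    intro S' c' h' hV'
    obtain ⟨m', hm', hc', hvol, hg⟩ := h'.exists_profile hκ hγ hγπ
    obtain rfl : m' = m :=
      profileVolume_injOn hκ hγ hγπ hm' hm (by rw [← hvol, hV', hmV])
    exact ⟨hc', hg⟩
  refine ⟨S, _, hS, hSV.trans hmV, fun S' c' h' hV' => ?_⟩
  obtain ⟨-, f, hf, hfS⟩ := unique S _ hS (hSV.trans hmV)
  obtain ⟨hc', g, hg, hgS⟩ := unique S' c' h' hV'
  -- Both surfaces are carried onto the same model cylinder, so one map followed by the inverse of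
  -- the other relates them.
  refine ⟨hc', f.trans g.symm, fun p => ?_, ?_⟩
  · rw [IsometryEquiv.trans_apply, ← hg, IsometryEquiv.apply_symm_apply, hf]
  · change (fun p => g.symm (f p)) '' _ = _
    rw [← Set.image_image, hfS, ← hgS, Set.image_image]
    simp
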